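/- Rings are unital and associative, and modules are right modules. A ring $R$ has *unbounded generating number* (UGN) if, for every integer $n\ge 1$, there is no $R$-module epimorphism $R^n\to R^{n+1}$. Let $G$ be a group. For $X\subseteq G$ and a ring $R$, the *translation ring* $T_G(X,R)$ is the ring of all $X\times X$ matrices $M$ over $R$ for which there is a finite set $K\subseteq G$ such that $M(x,y)=0$ whenever $y\notin Kx$, with entrywise addition and the usual matrix product $(MN)(x,y)=\sum_{z\in X}M(x,z)N(z,y)$ (a sum with only finitely many nonzero terms). Write $T(G,R)=T_G(G,R)$. A subset $X\subseteq G$ is *amenable with respect to $G$* if there is a function $\mu:\mathcal P(G)\to[0,\infty]$ such that $\mu(A\cup B)=\mu(A)+\mu(B)$ for all disjoint $A,B\subseteq G$, $\mu(gA)=\mu(A)$ for all $g\in G$ and $A\subseteq G$, and $\mu(X)=1$. The group $G$ is *supramenable* if every nonempty subset of $G$ is amenable with respect to $G$. The group $G$ is *amenable* if there is a function $\mu:\mathcal P(G)\to[0,1]$ satisfying the first two of these conditions and $\mu(G)=1$. **Corollary.** Let $G$ be a group. 1. $G$ is supramenable if and only if, for every ring $R$ and every nonempty subset $X\subseteq G$,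 the ring $T_G(X,R)$ has UGN exactly when $R$ has UGN. 2. $G$ is amenable if and only if, for every ring $R$, the ring $T(G,R)$ has UGN exactly when $R$ has UGN. -/

import Mathlib

universe u v

/-- `R` has unbounded generating number: for every positive integer `n`, there is no epimorphism
`Rⁿ → Rⁿ⁺¹` of right `R`-modules (right `R`-modules are modules over `Rᵐᵒᵖ`). -/
def HasUGN (R : Type v) [Ring R] : Prop :=
  ∀ n : ℕ, 0 < n →
    ¬ ∃ f : (Fin n → R) →ₗ[Rᵐᵒᵖ] (Fin (n + 1) → R), Function.Surjective f

/-- `X` is amenable with respect to the ambient group `G`: there is a finitely additive, left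
invariant function from the power set of `G` to `[0, ∞]` that assigns the value `1` to `X`. -/
def IsAmenableSubset {G : Type u} [Group G] (X : Set G) : Prop :=
  ∃ μ : Set G → ENNReal,
    (∀ A B : Set G, A ∩ B = ∅ → μ (A ∪ B) = μ A + μ B) ∧
    (∀ (g : G) (A : Set G), μ ((fun x => g * x) '' A) = μ A) ∧
    μ X = 1

/-- `G` is amenable: there is a finitely additive, left invariant function from the power set of
`G` to `[0, 1]` that assigns the value `1` to `G`. -/
def IsAmenableGroup (G : Type u) [Group G] : Prop :=
  ∃ μ : Set G → ℝ,
    (∀ A : Set G, μ A ∈ Set.Icc (0 : ℝ) 1) ∧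
    (∀ A B : Set G, A ∩ B = ∅ → μ (A ∪ B) = μ A + μ B) ∧
    (∀ (g : G) (A : Set G), μ ((fun x => g * x) '' A) = μ A) ∧
    μ Set.univ = 1

/-- `G` is supramenable: every nonempty subset of `G` is amenable with respect to `G`. -/
def IsSupramenableGroup (G : Type u) [Group G] : Prop :=
  ∀ X : Set G, X.Nonempty → IsAmenableSubset X

/-- The underlying set of the translation ring `T_G(X, R)`: the `X × X` matrices `M` over `R` for
which there is a finite `K ⊆ G` such that `M x y = 0` whenever `y ∉ K x`. For empty `X` it has
exactly one element. -/
def TranslationRing {G : Type u} [Group G] (X : Set G) (R : Type v) [Ring R] : Type (max u v) :=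
  {M : Matrix X X R // ∃ K : Set G, K.Finite ∧
    ∀ x y : X, (y : G) ∉ (fun k => k * (x : G)) '' K → M x y = 0}

namespace TranslationRing

variable {G : Type u} [Group G] {X : Set G} {R : Type v} [Ring R]

@[ext]
theorem ext {M N : TranslationRing X R} (h : ∀ x y, M.1 x y = N.1 x y) : M = N :=
  Subtype.ext (Matrix.ext h)

theorem finite_row (M : TranslationRing X R) (x : X) :
    (Function.support fun y => M.1 x y).Finite := by
  obtain ⟨K, hK, h⟩ := M.2
  refine ((hK.image fun k => k * (x : G)).preimage Subtype.val_injective.injOn).subset ?_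
  intro y hy
  by_contra hc
  exact hy (h x y hc)

theorem finite_mul_left (M : TranslationRing X R) (x : X) (f : X → R) :
    (Function.support fun z => M.1 x z * f z).Finite :=
  (M.finite_row x).subset fun z hz h0 => hz (by
    have h1 : M.1 x z = 0 := h0
    simp [h1])

instance : Zero (TranslationRing X R) := ⟨⟨0, ∅, Set.finite_empty, fun _ _ _ => rfl⟩⟩

open scoped Classical in
noncomputable instance : One (TranslationRing X R) :=
  ⟨⟨1, {1}, Set.finite_singleton 1, fun x y h => Matrix.one_apply_ne fun hxy => h (by simp [hxy])⟩⟩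

instance : Neg (TranslationRing X R) :=
  ⟨fun M => ⟨-M.1, by
    obtain ⟨K, hK, h⟩ := M.2
    exact ⟨K, hK, fun x y hxy => by simp [h x y hxy]⟩⟩⟩

instance : Add (TranslationRing X R) :=
  ⟨fun M N => ⟨M.1 + N.1, by
    obtain ⟨K, hK, h⟩ := M.2
    obtain ⟨L, hL, h'⟩ := N.2
    refine ⟨K ∪ L, hK.union hL, fun x y hxy => ?_⟩
    rw [Set.image_union, Set.mem_union, not_or] at hxy
    simp [h x y hxy.1, h' x y hxy.2]⟩⟩

/-- The usual matrix product `(M N) x y = ∑ z ∈ X, M x z * N z y`; only finitely many terms of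
the sum are nonzero. -/
noncomputable instance : Mul (TranslationRing X R) :=
  ⟨fun M N => ⟨fun x y => ∑ᶠ z : X, M.1 x z * N.1 z y, by
    obtain ⟨K, hK, h⟩ := M.2
    obtain ⟨L, hL, h'⟩ := N.2
    refine ⟨Set.image2 (fun l k => l * k) L K, hL.image2 _ hK, fun x y hxy => ?_⟩
    refine finsum_eq_zero_of_forall_eq_zero fun z => ?_
    by_cases hz : (z : G) ∈ (fun k => k * (x : G)) '' K
    · by_cases hy : (y : G) ∈ (fun k => k * (z : G)) '' L
      · obtain ⟨k, hk, hkz⟩ := hz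
        obtain ⟨l, hl, hly⟩ := hy
        refine absurd ⟨l * k, ⟨l, hl, k, hk, rfl⟩, ?_⟩ hxy
        simp only at hkz hly ⊢
        rw [mul_assoc, hkz, hly]
      · rw [h' z y hy, mul_zero]
    · rw [h x z hz, zero_mul]⟩⟩

@[simp] theorem zero_val : (0 : TranslationRing X R).1 = 0 := rfl

open scoped Classical in
theorem one_val : (1 : TranslationRing X R).1 = 1 := rfl

@[simp] theorem add_val (M N : TranslationRing X R) : (M + N).1 = M.1 + N.1 := rfl

@[simp] theorem neg_val (M : TranslationRing X R) : (-M).1 = -M.1 := rfl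

theorem mul_val (M N : TranslationRing X R) (x y : X) :
    (M * N).1 x y = ∑ᶠ z : X, M.1 x z * N.1 z y := rfl

theorem mul_val_eq_sum (M N : TranslationRing X R) (x y : X) (S : Finset X)
    (hS : ∀ z, z ∉ S → M.1 x z = 0) : (M * N).1 x y = ∑ z ∈ S, M.1 x z * N.1 z y := by
  rw [mul_val]
  refine finsum_eq_sum_of_support_subset _ fun z hz => ?_
  by_contra hc
  exact hz (by simp [hS z hc])

theorem mul_assoc' (M N P : TranslationRing X R) : M * N * P = M * (N * P) := by
  classical
  ext x y
  let S : Finset X := (M.finite_row x).toFinset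
  have hS : ∀ z, z ∉ S → M.1 x z = 0 := fun z hz => by simpa [S] using hz
  let S' : Finset X := S.biUnion fun w => (N.finite_row w).toFinset
  have hS' : ∀ w ∈ S, ∀ z, z ∉ S' → N.1 w z = 0 := fun w hw z hz => by
    by_contra hc
    exact hz (Finset.mem_biUnion.2 ⟨w, hw, by simpa using hc⟩)
  rw [mul_val_eq_sum M (N * P) x y S hS, mul_val_eq_sum (M * N) P x y S']
  · rw [Finset.sum_congr rfl fun z _ => by rw [mul_val_eq_sum M N x z S hS, Finset.sum_mul],
      Finset.sum_comm]
    refine Finset.sum_congr rfl fun w hw => ?_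
    rw [mul_val_eq_sum N P w y S' (hS' w hw), Finset.mul_sum]
    simp only [mul_assoc]
  · intro z hz
    rw [mul_val_eq_sum M N x z S hS]
    exact Finset.sum_eq_zero fun w hw => by rw [hS' w hw z hz, mul_zero]

noncomputable instance : Ring (TranslationRing X R) where
  add_assoc M N P := by ext; simp [add_assoc]
  zero_add M := by ext; simp
  add_zero M := by ext; simp
  add_comm M N := by ext; simp [add_comm]
  neg_add_cancel M := by ext; simp
  nsmul := nsmulRec
  zsmul := zsmulRec
  mul_assoc := mul_assoc'
  zero_mul M := by ext x y; simp [mul_val]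
  mul_zero M := by ext x y; simp [mul_val]
  one_mul M := by
    classical
    ext x y
    rw [mul_val_eq_sum 1 M x y {x}]
    · simp [one_val]
    · intro z hz
      rw [one_val]
      exact Matrix.one_apply_ne fun h => hz (by simp [h])
  mul_one M := by
    classical
    ext x y
    rw [mul_val_eq_sum M 1 x y (M.finite_row x).toFinset fun z hz => by simpa using hz]
    simp only [one_val, Matrix.one_apply, mul_ite, mul_one, mul_zero]
    rw [Finset.sum_ite_eq']
    split_ifs with h
    · rfl
    · exact (by simpa using h : M.1 x y = 0).symm
  left_distrib M N P := by
    ext x y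
    simp only [mul_val, add_val, Matrix.add_apply, mul_add]
    exact finsum_add_distrib (M.finite_mul_left x _) (M.finite_mul_left x _)
  right_distrib M N P := by
    ext x y
    simp only [mul_val, add_val, Matrix.add_apply, add_mul]
    exact finsum_add_distrib (M.finite_mul_left x _) (N.finite_mul_left x _)

end TranslationRing

/-!
A ring has unbounded generating number precisely when no identity matrix of size `n + 1` is a
product `A * B` through size `n ≥ 1`. Scalar matrices map `R` to `TranslationRing X R`, so
the generating number of `R` is unbounded as soon as that of the translation ring is. The converse
and amenability of `X` are both governed by one combinatorial condition, `HasShrinkingInjection X`: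
for some `n ≥ 1` there is an injection from `n + 1` copies of `X` into `n` copies of `X` that
displaces points by a finite subset of `G` only.

* If such an injection exists, its 0-1 matrix and the transpose show that no translation ring over
  `X` has unbounded generating number (`HasShrinkingInjection.not_hasUGN`), and an invariant measure
  with `μ X = 1` would satisfy `n + 1 ≤ n` (`HasShrinkingInjection.not_isAmenableSubset`).
* If none exists, Hall's marriage theorem gives, for every finite `K ⊆ G` and `n ≥ 1`, a finite
  `F ⊆ X` with `n * |K F ∩ X| < (n + 1) * |F|` (`exists_card_biUnion_translates_lt`). Cutting a
  factorization `A * B = 1` over the translation ring down to such an `F` yields one over `R`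
  through a smaller size (`HasUGN.translationRing`). An ultrafilter limit of the normalized
  counting measures on these `F` is invariant under translations inside `X`, and it extends to an
  invariant measure on all subsets of `G`
  (`isAmenableSubset_of_partially_invariant_mean`).

Hence `X` is amenable with respect to `G` if and only if, for all `R`, the generating number of
`TranslationRing X R` is unbounded exactly when that of `R` is; for the nontrivial direction one
commutative ring, such as `ℤ`, is enough. Both equivalences of the corollary follow.
-/

/-! ### Unbounded generating number in terms of matrices -/

theorem hasUGN_iff_matrix (R : Type v) [Ring R] :
    HasUGN R ↔ ∀ n : ℕ, 0 < n → ∀ (A : Matrix (Fin (n + 1)) (Fin n) R)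
      (B : Matrix (Fin n) (Fin (n + 1)) R), A * B ≠ 1 := by
  refine forall₂_congr fun n _ => ⟨fun h A B hAB => h ?_, fun h => ?_⟩
  · refine ⟨{ toFun := fun v => A.mulVec v
              map_add' := fun v w => A.mulVec_add v w
              map_smul' := fun r v => ?_ }, fun w => ⟨B.mulVec w, ?_⟩⟩
    · ext i
      simp [Matrix.mulVec, dotProduct, Finset.sum_mul, mul_assoc]
    · change A.mulVec (B.mulVec w) = w
      rw [Matrix.mulVec_mulVec, hAB, Matrix.one_mulVec]
  · rintro ⟨f, hf⟩
    choose b hb using fun j : Fin (n + 1) => hf (Pi.single j 1)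
    refine h (Matrix.of fun i j => f (Pi.single j 1) i) (Matrix.of fun j i => b i j) ?_
    ext i k
    have hbk : b k = ∑ j, MulOpposite.op (b k j) • (Pi.single j 1 : Fin n → R) := by
      ext l
      simp [Finset.sum_apply, Pi.single_apply]
    have hk := congrFun (hb k) i
    rw [hbk, map_sum] at hk
    simp only [map_smul, Finset.sum_apply, Pi.smul_apply, MulOpposite.smul_eq_mul_unop,
      MulOpposite.unop_op] at hk
    simp only [Matrix.mul_apply, Matrix.of_apply, hk, Pi.single_apply, Matrix.one_apply]

/-- Size `0` of `κ` is covered as well, because a ring with unbounded generating number is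
nontrivial. -/
theorem HasUGN.card_le_of_mul_eq_one {R : Type v} [Ring R] (hR : HasUGN R)
    {ι κ : Type*} [Fintype ι] [Fintype κ] [DecidableEq ι]
    (A : Matrix ι κ R) (B : Matrix κ ι R) (hAB : A * B = 1) :
    Fintype.card ι ≤ Fintype.card κ := by
  rw [hasUGN_iff_matrix] at hR
  by_contra! hlt
  obtain ⟨e⟩ : Nonempty (Fin (Fintype.card κ + 1) ↪ ι) :=
    Function.Embedding.nonempty_of_card_le (by simpa using hlt)
  rcases Nat.eq_zero_or_pos (Fintype.card κ) with h0 | hpos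
  · have : IsEmpty κ := Fintype.card_eq_zero_iff.1 h0
    have h10 : (1 : R) = 0 := by
      simpa [Matrix.mul_apply] using (congrFun (congrFun hAB (e 0)) (e 0)).symm
    have : Subsingleton R := subsingleton_of_zero_eq_one h10.symm
    exact hR 1 one_pos 0 0 (Subsingleton.elim _ _)
  · refine hR _ hpos (A.submatrix e (Fintype.equivFin κ).symm)
      (B.submatrix (Fintype.equivFin κ).symm e) ?_
    rw [Matrix.submatrix_mul_equiv, hAB, Matrix.submatrix_one _ e.injective]

theorem hasUGN_of_commRing (R : Type v) [CommRing R] [Nontrivial R] : HasUGN R := by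
  rw [hasUGN_iff_matrix]
  intro n _ A B hAB
  have hsurj : Function.Surjective A.mulVecLin := fun w =>
    ⟨B.mulVec w, by rw [Matrix.mulVecLin_apply, Matrix.mulVec_mulVec, hAB, Matrix.one_mulVec]⟩
  exact absurd (le_of_fin_surjective R A.mulVecLin hsurj) (by omega)

theorem HasUGN.of_ringHom {R S : Type*} [Ring R] [Ring S] (f : R →+* S) (hS : HasUGN S) :
    HasUGN R := by
  rw [hasUGN_iff_matrix] at hS ⊢
  intro n hn A B hAB
  refine hS n hn (A.map f) (B.map f) ?_
  rw [← Matrix.map_mul, hAB, Matrix.map_one f (map_zero f) (map_one f)]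

namespace TranslationRing

variable {G : Type u} [Group G] {X : Set G} {R : Type v} [Ring R]

open scoped Classical in
/-- The diagonal matrix with all diagonal entries equal to `r`. -/
noncomputable def scalarMatrix (X : Set G) (r : R) : TranslationRing X R :=
  ⟨Matrix.diagonal fun _ => r, {1}, Set.finite_singleton 1, fun x y h =>
    Matrix.diagonal_apply_ne _ fun hxy => h (by simp [hxy])⟩

open scoped Classical in
theorem scalarMatrix_val (r : R) (x y : X) :
    (scalarMatrix X r).1 x y = if x = y then r else 0 := rfl

/-- The ring homomorphism that sends `r` to the scalar matrix `r`. -/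
noncomputable def scalar (X : Set G) (R : Type v) [Ring R] : R →+* TranslationRing X R where
  toFun := scalarMatrix X
  map_one' := by
    ext x y
    classical
    rw [scalarMatrix_val, one_val, Matrix.one_apply]
  map_zero' := by
    ext x y
    rw [scalarMatrix_val, ite_self]
    rfl
  map_add' r s := by
    ext x y
    rw [add_val, Matrix.add_apply]
    simp only [scalarMatrix_val]
    split_ifs <;> simp
  map_mul' r s := by
    classical
    ext x y
    rw [mul_val_eq_sum _ _ x y {x}]
    · simp only [Finset.sum_singleton, scalarMatrix_val, if_true]
      split_ifs <;> simp
    · intro z hz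
      rw [scalarMatrix_val, if_neg fun h => hz (by simp [h])]

theorem sum_val {ι : Type*} (s : Finset ι) (f : ι → TranslationRing X R) (x y : X) :
    (∑ i ∈ s, f i).1 x y = ∑ i ∈ s, (f i).1 x y := by
  classical
  induction s using Finset.induction_on with
  | empty => simp
  | insert a s ha ih => rw [Finset.sum_insert ha, Finset.sum_insert ha, add_val, ← ih]; rfl

end TranslationRing

/-! ### Injections of bounded displacement -/

section Displacement

variable {G : Type u} [Group G]

/-- There are a positive integer `n` and an injection from `n + 1` copies of `X` into `n` copies of
`X` that moves every point by left multiplication by an element of a fixed finite set. In terms of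
equidecomposability, this says `(n + 1) [X] ≤ n [X]`. -/
def HasShrinkingInjection (X : Set G) : Prop :=
  ∃ (n : ℕ) (K : Finset G) (φ : X × Fin (n + 1) → X × Fin n), 0 < n ∧ Function.Injective φ ∧
    ∀ p, ((φ p).1 : G) * (p.1 : G)⁻¹ ∈ K

open scoped Classical in
/-- The points `k * x` of `X` with `k ∈ K`. -/
noncomputable def translates {X : Set G} (K : Finset G) (x : X) : Finset X :=
  (K.image fun k => k * (x : G)).subtype (· ∈ X)

theorem mem_translates {X : Set G} {K : Finset G} {x y : X} :
    y ∈ translates K x ↔ (y : G) * (x : G)⁻¹ ∈ K := by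
  classical
  simp only [translates, Finset.mem_subtype, Finset.mem_image]
  exact ⟨fun ⟨k, hk, h⟩ => by rwa [← h, mul_inv_cancel_right], fun h => ⟨_, h, by group⟩⟩

open scoped Classical in
/-- Hall's marriage theorem: were every finite set to grow by a factor of at least `(n + 1) / n`
under `K`, a matching would be a shrinking injection. -/
theorem exists_card_biUnion_translates_lt {X : Set G} (hX : ¬ HasShrinkingInjection X)
    (K : Finset G) {n : ℕ} (hn : 0 < n) :
    ∃ F : Finset X, n * (F.biUnion (translates K)).card < (n + 1) * F.card := by
  by_contra! h
  let t : X × Fin (n + 1) → Finset (X × Fin n) := fun p => translates K p.1 ×ˢ Finset.univ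
  have hall : ∀ s : Finset (X × Fin (n + 1)), s.card ≤ (s.biUnion t).card := by
    intro s
    have h1 : s ⊆ s.image Prod.fst ×ˢ Finset.univ := fun p hp =>
      Finset.mem_product.2 ⟨Finset.mem_image_of_mem _ hp, Finset.mem_univ _⟩
    have h2 : s.biUnion t = (s.image Prod.fst).biUnion (translates K) ×ˢ Finset.univ := by
      ext ⟨y, j⟩
      simp [t]
    calc s.card ≤ (s.image Prod.fst ×ˢ (Finset.univ : Finset (Fin (n + 1)))).card :=
          Finset.card_le_card h1
      _ = (n + 1) * (s.image Prod.fst).card := by simp [mul_comm]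
      _ ≤ n * ((s.image Prod.fst).biUnion (translates K)).card := h _
      _ = (s.biUnion t).card := by rw [h2]; simp [mul_comm]
  obtain ⟨φ, hφ, hφt⟩ := (Finset.all_card_le_biUnion_card_iff_exists_injective t).1 hall
  exact hX ⟨n, K, φ, hn, hφ, fun p => mem_translates.1 (Finset.mem_product.1 (hφt p)).1⟩

/-! ### Translation rings and shrinking injections -/

/-- A factorization of the identity of size `n + 1` through size `n` over the translation ring,
restricted to a finite set `F` that hardly grows under the common support of the matrices, factors
the identity of `R^((n + 1) * |F|)` through a free module of smaller rank. -/
theorem HasUGN.translationRing {R : Type v} [Ring R] (hR : HasUGN R) {X : Set G}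
    (hX : ¬ HasShrinkingInjection X) : HasUGN (TranslationRing X R) := by
  classical
  rw [hasUGN_iff_matrix]
  intro n hn A B hAB
  obtain ⟨K, hK⟩ : ∃ K : Finset G, ∀ i j, ∀ x y : X, (y : G) * (x : G)⁻¹ ∉ K →
      (A i j).1 x y = 0 := by
    choose K hKf hK using fun i j => (A i j).2
    refine ⟨Finset.univ.biUnion fun i => Finset.univ.biUnion fun j => (hKf i j).toFinset,
      fun i j x y hxy => hK i j x y ?_⟩
    rintro ⟨k, hk, hkx : k * (x : G) = y⟩
    refine hxy ?_
    simp only [Finset.mem_biUnion, Finset.mem_univ, true_and, Set.Finite.mem_toFinset]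
    exact ⟨i, j, by simpa [← hkx] using hk⟩
  obtain ⟨F, hF⟩ := exists_card_biUnion_translates_lt hX K hn
  set N := F.biUnion (translates K) with hN
  let A' : Matrix (F × Fin (n + 1)) (N × Fin n) R := fun p q => (A p.2 q.2).1 p.1 q.1
  let B' : Matrix (N × Fin n) (F × Fin (n + 1)) R := fun q p => (B q.2 p.2).1 q.1 p.1
  have hmul : A' * B' = 1 := by
    ext ⟨x, i⟩ ⟨y, i'⟩
    have hsupp : ∀ j, ∀ z, z ∉ N → (A i j).1 x z = 0 := fun j z hz => hK i j _ _ fun hc =>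
      hz (Finset.mem_biUnion.2 ⟨x, x.2, mem_translates.2 hc⟩)
    have h := congrArg (fun M : TranslationRing X R => M.1 x y) (congrFun (congrFun hAB i) i')
    simp only [Matrix.mul_apply, TranslationRing.sum_val] at h
    rw [Finset.sum_congr rfl fun j _ =>
      TranslationRing.mul_val_eq_sum _ _ _ _ N (hsupp j)] at h
    rw [Matrix.mul_apply, Fintype.sum_prod_type_right]
    simp only [A', B']
    rw [Finset.sum_congr rfl fun j _ =>
      Finset.sum_coe_sort N fun z => (A i j).1 x z * (B j i').1 z y, h]
    by_cases hi : i = i'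
    · subst hi
      rw [Matrix.one_apply_eq, TranslationRing.one_val]
      by_cases hxy : x = y
      · rw [hxy, Matrix.one_apply_eq, Matrix.one_apply_eq]
      · rw [Matrix.one_apply_ne fun hc => hxy (Subtype.ext hc),
          Matrix.one_apply_ne fun hc => hxy (Prod.ext_iff.1 hc).1]
    · rw [Matrix.one_apply_ne hi, Matrix.one_apply_ne fun hc => hi (Prod.ext_iff.1 hc).2]
      rfl
  have hcard := hR.card_le_of_mul_eq_one A' B' hmul
  simp only [Fintype.card_prod, Fintype.card_coe, Fintype.card_fin] at hcard
  rw [mul_comm F.card, mul_comm N.card] at hcard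
  exact absurd hF (not_lt.2 hcard)

/-- A shrinking injection, read as a 0-1 matrix `A`, has its transpose as a right inverse. -/
theorem HasShrinkingInjection.not_hasUGN {X : Set G} (hX : HasShrinkingInjection X)
    (R : Type v) [Ring R] : ¬ HasUGN (TranslationRing X R) := by
  classical
  obtain ⟨n, K, φ, hn, hφ, hK⟩ := hX
  obtain ⟨A, hA⟩ : ∃ A : Fin (n + 1) → Fin n → TranslationRing X R,
      ∀ i j x z, (A i j).1 x z = if φ (x, i) = (z, j) then 1 else 0 := by
    refine ⟨fun i j => ⟨fun x z => if φ (x, i) = (z, j) then 1 else 0, K, K.finite_toSet,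
      fun x z hz => if_neg fun hc => hz ?_⟩, fun _ _ _ _ => rfl⟩
    have h := hK (x, i)
    rw [hc] at h
    exact ⟨_, h, by group⟩
  obtain ⟨B, hB⟩ : ∃ B : Fin n → Fin (n + 1) → TranslationRing X R,
      ∀ j i z x, (B j i).1 z x = if φ (x, i) = (z, j) then 1 else 0 := by
    refine ⟨fun j i => ⟨fun z x => if φ (x, i) = (z, j) then 1 else 0, (· ⁻¹) '' (K : Set G),
      K.finite_toSet.image _, fun z x hz => if_neg fun hc => hz ?_⟩, fun _ _ _ _ => rfl⟩
    have h := hK (x, i)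
    rw [hc] at h
    exact ⟨_, ⟨_, h, rfl⟩, by group⟩
  rw [hasUGN_iff_matrix]
  refine fun h => h n hn (Matrix.of A) (Matrix.of B) ?_
  ext i i' x y
  rw [Matrix.mul_apply, TranslationRing.sum_val]
  simp only [Matrix.of_apply]
  rw [Finset.sum_congr rfl fun j _ =>
    TranslationRing.mul_val_eq_sum _ _ x y {(φ (x, i)).1} fun z hz =>
      (hA i j x z).trans (if_neg fun hc => hz (by simp [hc]))]
  simp only [Finset.sum_singleton, hA, hB]
  rw [Finset.sum_eq_single (φ (x, i)).2]
  · rw [Prod.mk.eta, if_pos rfl, one_mul]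
    simp only [hφ.eq_iff, Prod.mk.injEq]
    by_cases hi : i = i'
    · subst hi
      rw [Matrix.one_apply_eq, TranslationRing.one_val, Matrix.one_apply]
      simp [eq_comm]
    · rw [Matrix.one_apply_ne hi, if_neg fun hc => hi hc.2.symm]
      rfl
  · intro j _ hj
    rw [if_neg fun hc => hj (by rw [hc]), zero_mul]
  · simp

/-! ### Shrinking injections exclude invariant measures -/

/-- Summing an invariant measure `μ` over the pieces of the injection on which the displacement is
constant would give `(n + 1) * μ X ≤ n * μ X`. -/
theorem HasShrinkingInjection.not_isAmenableSubset {X : Set G} (hX : HasShrinkingInjection X) :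
    ¬ IsAmenableSubset X := by
  classical
  rintro ⟨μ, hadd, hinv, hμX⟩
  obtain ⟨n, K, φ, hn, hφ, hK⟩ := hX
  have h0 : μ ∅ = 0 := by
    have h := hadd X ∅ (Set.inter_empty X)
    rw [Set.union_empty, hμX] at h
    exact ((ENNReal.add_right_inj ENNReal.one_ne_top).1 (by simpa using h)).symm
  have hmono : ∀ A B : Set G, A ⊆ B → μ A ≤ μ B := fun A B hAB => by
    have h := hadd A (B \ A) (Set.inter_sdiff_self A B)
    rw [Set.union_sdiff_cancel hAB] at h
    exact h ▸ le_self_add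
  have hsum : ∀ {ι : Type u} (s : Finset ι) (A : ι → Set G),
      (s : Set ι).PairwiseDisjoint A → μ (⋃ i ∈ s, A i) = ∑ i ∈ s, μ (A i) := by
    intro ι s A
    induction s using Finset.induction_on with
    | empty => simp [h0]
    | insert a s ha ih =>
      intro hd
      rw [Finset.sum_insert ha, Finset.set_biUnion_insert, hadd, ih]
      · exact hd.subset (by simp)
      · rw [← Set.disjoint_iff_inter_eq_empty, Set.disjoint_iUnion₂_right]
        intro i hi
        exact hd (by simp) (by simp [hi]) (fun h => ha (h ▸ hi))
  -- `P i k j` is the set of points of the `i`-th copy moved by `k` into the `j`-th copy.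
  let P : Fin (n + 1) → G → Fin n → Set G := fun i k j =>
    {g | ∃ x : X, (x : G) = g ∧ ((φ (x, i)).1 : G) = k * g ∧ (φ (x, i)).2 = j}
  have hsource : ∀ i, ∑ p ∈ K ×ˢ (Finset.univ : Finset (Fin n)), μ (P i p.1 p.2) = 1 := by
    intro i
    rw [← hsum, ← hμX]
    · congr 1
      ext g
      simp only [Set.mem_iUnion, Finset.mem_product, Finset.mem_univ, and_true, exists_prop, P]
      constructor
      · rintro ⟨_, _, x, rfl, _⟩
        exact x.2
      · intro hg
        exact ⟨⟨_, (φ (⟨g, hg⟩, i)).2⟩, hK (⟨g, hg⟩, i), ⟨g, hg⟩, rfl, by simp, rfl⟩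
    · rintro ⟨k, j⟩ _ ⟨k', j'⟩ _ hne
      refine Set.disjoint_left.2 ?_
      rintro _ ⟨x, rfl, h1, h2⟩ ⟨y, hy, h1', h2'⟩
      obtain rfl := Subtype.ext hy
      exact hne (Prod.ext (mul_right_cancel (h1.symm.trans h1')) (h2.symm.trans h2'))
  have htarget : ∀ j, ∑ p ∈ (Finset.univ : Finset (Fin (n + 1))) ×ˢ K, μ (P p.1 p.2 j) ≤ 1 := by
    intro j
    rw [← hμX, Finset.sum_congr rfl fun p _ => (hinv p.2 (P p.1 p.2 j)).symm, ← hsum]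
    · refine hmono _ _ (Set.iUnion₂_subset ?_)
      rintro ⟨i, k⟩ _ _ ⟨_, ⟨x, rfl, h1, _⟩, rfl⟩
      change k * (x : G) ∈ X
      exact h1 ▸ (φ (x, i)).1.2
    · rintro ⟨i, k⟩ _ ⟨i', k'⟩ _ hne
      refine Set.disjoint_left.2 ?_
      rintro _ ⟨_, ⟨x, rfl, h1, h2⟩, rfl⟩ ⟨_, ⟨y, rfl, h1', h2'⟩, heq⟩
      have hxy : φ (x, i) = φ (y, i') :=
        Prod.ext (Subtype.ext (h1.trans (heq.symm.trans h1'.symm))) (h2.trans h2'.symm)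
      obtain ⟨rfl, rfl⟩ := Prod.ext_iff.1 (hφ hxy)
      exact hne (Prod.ext rfl (mul_right_cancel heq).symm)
  have hle : ((n + 1 : ℕ) : ENNReal) ≤ (n : ℕ) := by
    calc ((n + 1 : ℕ) : ENNReal)
        = ∑ i : Fin (n + 1), ∑ p ∈ K ×ˢ (Finset.univ : Finset (Fin n)), μ (P i p.1 p.2) := by
          simp [hsource]
      _ = ∑ j : Fin n, ∑ p ∈ (Finset.univ : Finset (Fin (n + 1))) ×ˢ K, μ (P p.1 p.2 j) := by
          simp only [Finset.sum_product]
          rw [Finset.sum_comm (s := (Finset.univ : Finset (Fin n)))]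
          exact Finset.sum_congr rfl fun i _ => Finset.sum_comm
      _ ≤ ∑ _j : Fin n, 1 := Finset.sum_le_sum fun j _ => htarget j
      _ = (n : ℕ) := by simp
  exact absurd (Nat.cast_le.1 hle) (by omega)

/-! ### Invariant measures in the absence of shrinking injections -/

/-- The mean is an ultrafilter limit of normalized counting measures along a net of finite sets
`F ⊆ X` that grow less and less under larger and larger finite sets of translations. -/
theorem exists_partially_invariant_mean {X : Set G} (hX : ¬ HasShrinkingInjection X) :
    ∃ ν : Set G → ENNReal, (∀ A B : Set G, A ∩ B = ∅ → ν (A ∪ B) = ν A + ν B) ∧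
      (∀ (g : G) (A : Set G), A ⊆ X → (fun x => g * x) '' A ⊆ X →
        ν ((fun x => g * x) '' A) = ν A) ∧ ν X = 1 := by
  classical
  choose F hF using fun p : Finset G × ℕ =>
    exists_card_biUnion_translates_lt hX p.1 (Nat.succ_pos p.2)
  have hFpos : ∀ p, 0 < (F p).card := fun p => by
    by_contra h
    have := hF p
    rw [Nat.eq_zero_of_not_pos h] at this
    omega
  let count : Set G → Finset G × ℕ → ℕ := fun A p => ((F p).filter fun x : X => (x : G) ∈ A).card
  let a : Set G → Finset G × ℕ → ENNReal := fun A p => count A p / (F p).card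
  let U : Ultrafilter (Finset G × ℕ) := Ultrafilter.of Filter.atTop
  have hU : (U : Filter (Finset G × ℕ)) ≤ Filter.atTop := Ultrafilter.of_le _
  choose ν hν using fun A => show ∃ l, Filter.Tendsto (a A) U (nhds l) by
    obtain ⟨l, _, hl⟩ := isCompact_univ.ultrafilter_le_nhds (U.map (a A)) (by simp)
    exact ⟨l, hl⟩
  have hle : ∀ (g : G) (A : Set G), A ⊆ X → ν ((fun x => g * x) '' A) ≤ ν A := by
    intro g A hA
    have hlim : Filter.Tendsto (fun p : Finset G × ℕ => a A p + ((p.2 : ENNReal) + 1)⁻¹) U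
        (nhds (ν A + 0)) := by
      refine (hν A).add (Filter.Tendsto.mono_left ?_ hU)
      rw [← Filter.prod_atTop_atTop_eq]
      have h1 : Filter.Tendsto (fun n : ℕ => ((n : ENNReal) + 1)⁻¹) Filter.atTop (nhds 0) := by
        simpa using (Filter.tendsto_add_atTop_iff_nat 1).2 ENNReal.tendsto_inv_nat_nhds_zero
      exact h1.comp Filter.tendsto_snd
    rw [add_zero] at hlim
    -- It remains to compare the two counts once `1` and `g⁻¹` are among the translations.
    refine le_of_tendsto_of_tendsto (hν _) hlim (hU ?_)
    filter_upwards [Filter.eventually_ge_atTop (({1, g⁻¹} : Finset G), 0)] with p hp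
    have h1 : (1 : G) ∈ p.1 := hp.1 (by simp)
    have hg : g⁻¹ ∈ p.1 := hp.1 (by simp)
    have hFN : F p ⊆ (F p).biUnion (translates p.1) := fun x hx =>
      Finset.mem_biUnion.2 ⟨x, hx, mem_translates.2 (by simpa using h1)⟩
    set N := (F p).biUnion (translates p.1) with hN
    -- Points of `F` in `g A` come from points of `A` in `g⁻¹ F`, which lie in the enlargement.
    have hc1 : count ((fun x => g * x) '' A) p ≤ (N.filter fun x : X => (x : G) ∈ A).card := by
      refine Finset.card_le_card_of_surjOn
        (fun y => if h : g * (y : G) ∈ X then ⟨g * (y : G), h⟩ else y) ?_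
      rintro x hx
      obtain ⟨hxF, y, hyA, hyx : g * y = x⟩ := Finset.mem_filter.1 (Finset.mem_coe.1 hx)
      refine ⟨⟨y, hA hyA⟩, ?_, ?_⟩
      · refine Finset.mem_coe.2 (Finset.mem_filter.2 ⟨Finset.mem_biUnion.2 ⟨x, hxF, ?_⟩, hyA⟩)
        rw [mem_translates, ← hyx]
        simpa using hg
      · have : g * y ∈ X := hyx ▸ x.2
        simp only [this, dif_pos]
        exact Subtype.ext hyx
    have hc2 : (N.filter fun x : X => (x : G) ∈ A).card ≤ count A p + (N \ F p).card := by
      refine le_trans (Finset.card_le_card ?_) (Finset.card_union_le _ _)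
      intro x hx
      obtain ⟨hxN, hxA⟩ := Finset.mem_filter.1 hx
      by_cases hxF : x ∈ F p <;> simp [hxF, hxN, hxA]
    have hc3 : (p.2 + 1) * (N \ F p).card ≤ (F p).card := by
      have h := hF p
      have h' := Finset.card_sdiff_add_card_eq_card hFN
      simp only [← hN, Nat.succ_eq_add_one] at h
      rw [← h'] at h
      nlinarith
    have hFc : ((F p).card : ENNReal) ≠ 0 := by exact_mod_cast (hFpos p).ne'
    calc a ((fun x => g * x) '' A) p
        ≤ ((count A p + (N \ F p).card : ℕ) : ENNReal) / (F p).card := by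
          refine ENNReal.div_le_div_right ?_ _
          exact_mod_cast hc1.trans hc2
      _ = a A p + ((N \ F p).card : ENNReal) / (F p).card := by
          rw [Nat.cast_add, ENNReal.add_div]
      _ ≤ a A p + ((p.2 : ENNReal) + 1)⁻¹ := by
          gcongr
          refine ENNReal.div_le_of_le_mul ?_
          rw [mul_comm, ← div_eq_mul_inv,
            ENNReal.le_div_iff_mul_le (Or.inl (by simp)) (Or.inl (by finiteness)), mul_comm]
          exact_mod_cast hc3
  refine ⟨ν, fun A B hAB => ?_, fun g A hA hgA => le_antisymm (hle g A hA) ?_, ?_⟩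
  · refine tendsto_nhds_unique (hν (A ∪ B)) (((hν A).add (hν B)).congr fun p => ?_)
    simp only [a, count]
    rw [← ENNReal.add_div, ← Nat.cast_add, ← Finset.card_union_of_disjoint]
    · rw [← Finset.filter_or]
      simp only [Set.mem_union]
    · refine Finset.disjoint_filter.2 fun x _ hxA hxB => ?_
      exact Set.notMem_empty _ (hAB.subset ⟨hxA, hxB⟩)
  · simpa only [Set.image_image, inv_mul_cancel_left, Set.image_id'] using hle g⁻¹ _ hgA
  · refine tendsto_nhds_unique (hν X) (tendsto_const_nhds.congr fun p => ?_)
    have hFc : ((F p).card : ENNReal) ≠ 0 := by exact_mod_cast (hFpos p).ne'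
    simp [a, count, ENNReal.div_self hFc]

/-- Extends a partially invariant mean on `X` to an invariant measure on `G`. A function
`c : G → G` describes a way to carry pieces of a set back into `X`, moving `b` to `c b * b`;
the measure of `B` is the supremum over `c` of the total mass of the pieces that land in `X`. -/
theorem isAmenableSubset_of_partially_invariant_mean {X : Set G} (ν : Set G → ENNReal)
    (hadd : ∀ A B : Set G, A ∩ B = ∅ → ν (A ∪ B) = ν A + ν B)
    (hinv : ∀ (g : G) (A : Set G), A ⊆ X → (fun x => g * x) '' A ⊆ X →
      ν ((fun x => g * x) '' A) = ν A) (hX : ν X = 1) : IsAmenableSubset X := by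
  classical
  have h0 : ν ∅ = 0 := by
    have h := hadd X ∅ (Set.inter_empty X)
    rw [Set.union_empty, hX] at h
    exact ((ENNReal.add_right_inj ENNReal.one_ne_top).1 (by simpa using h)).symm
  have hmono : ∀ A B : Set G, A ⊆ B → ν A ≤ ν B := fun A B hAB => by
    have h := hadd A (B \ A) (Set.inter_sdiff_self A B)
    rw [Set.union_sdiff_cancel hAB] at h
    exact h ▸ le_self_add
  -- `piece c B s` is the part of `X` reached by the points of `B` that `c` moves by `s`.
  let piece : (G → G) → Set G → G → Set G := fun c B s =>
    {x | x ∈ X ∧ s⁻¹ * x ∈ B ∧ c (s⁻¹ * x) = s}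
  let mass : (G → G) → Set G → ENNReal := fun c B => ∑' s, ν (piece c B s)
  have mass_union : ∀ c A B, A ∩ B = ∅ → mass c (A ∪ B) = mass c A + mass c B := by
    intro c A B hAB
    simp only [mass]
    rw [← ENNReal.tsum_add]
    refine tsum_congr fun s => ?_
    rw [← hadd]
    · congr 1
      ext x
      simp only [piece, Set.mem_union, Set.mem_ofPred_eq]
      tauto
    · ext x
      simp only [piece, Set.mem_inter_iff, Set.mem_ofPred_eq, Set.mem_empty_iff_false, iff_false]
      exact fun h => Set.notMem_empty _ (hAB.subset ⟨h.1.2.1, h.2.2.1⟩)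
  have mass_congr : ∀ c c' B, (∀ b ∈ B, c b = c' b) → mass c B = mass c' B := by
    intro c c' B h
    refine tsum_congr fun s => congrArg ν ?_
    ext x
    simp only [piece, Set.mem_ofPred_eq]
    exact and_congr_right fun _ => and_congr_right fun hb => by rw [h _ hb]
  have hle : ∀ (g : G) (B : Set G), ⨆ c, mass c B ≤ ⨆ c, mass c ((fun x => g * x) '' B) := by
    intro g B
    refine iSup_le fun c => le_iSup_of_le (fun b => c (g⁻¹ * b) * g⁻¹) (le_of_eq ?_)
    simp only [mass]
    rw [← (Equiv.mulRight g⁻¹).tsum_eq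
      fun s => ν (piece (fun b => c (g⁻¹ * b) * g⁻¹) ((fun x => g * x) '' B) s)]
    refine tsum_congr fun s => congrArg ν ?_
    ext x
    simp [piece, mul_assoc]
  refine ⟨fun B => ⨆ c, mass c B, fun A B hAB => ?_, fun g B => le_antisymm ?_ (hle g B), ?_⟩
  · simp only [mass_union _ A B hAB]
    refine (ENNReal.iSup_add_iSup fun c c' => ⟨fun b => if b ∈ A then c b else c' b, ?_⟩).symm
    refine add_le_add (mass_congr _ _ _ fun b hb => (if_pos hb).symm).le
      (mass_congr _ _ _ fun b hb => (if_neg fun hA => ?_).symm).le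
    exact Set.notMem_empty _ (hAB.subset ⟨hA, hb⟩)
  · simpa only [Set.image_image, inv_mul_cancel_left, Set.image_id'] using
      hle g⁻¹ ((fun x => g * x) '' B)
  · refine le_antisymm (iSup_le fun c => ?_) ?_
    · -- Moving the pieces back gives disjoint subsets of `X` of the same mass.
      have hpiece : ∀ s, ν (piece c X s) = ν {x | x ∈ X ∧ s * x ∈ X ∧ c x = s} := by
        intro s
        have himage : (fun x => s * x) '' {x | x ∈ X ∧ s * x ∈ X ∧ c x = s} = piece c X s := by
          ext x
          simp only [piece, Set.image_mul_left, Set.mem_preimage, Set.mem_ofPred_eq,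
            mul_inv_cancel_left]
          tauto
        rw [← himage]
        exact hinv s _ (fun x hx => hx.1) (himage ▸ fun x hx => hx.1)
      have hfinite : ∀ t : Finset G, ∑ s ∈ t, ν {x | x ∈ X ∧ s * x ∈ X ∧ c x = s} ≤
          ν {x | x ∈ X ∧ c x ∈ t} := by
        intro t
        induction t using Finset.induction_on with
        | empty => simp
        | insert a t ha ih =>
          rw [Finset.sum_insert ha]
          refine (add_le_add_right ih _).trans ?_
          rw [← hadd]
          · refine hmono _ _ ?_
            rintro x (⟨h1, _, h3⟩ | ⟨h1, h2⟩)
            · exact ⟨h1, by simp [h3]⟩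
            · exact ⟨h1, by simp [h2]⟩
          · ext x
            simp only [Set.mem_inter_iff, Set.mem_ofPred_eq, Set.mem_empty_iff_false, iff_false]
            rintro ⟨⟨_, _, rfl⟩, _, h⟩
            exact ha h
      rw [← hX]
      simp only [mass, hpiece]
      rw [ENNReal.tsum_eq_iSup_sum]
      exact iSup_le fun t => (hfinite t).trans (hmono _ _ fun x hx => hx.1)
    · refine le_iSup_of_le (fun _ => 1) (le_trans ?_ (ENNReal.le_tsum 1))
      rw [← hX]
      exact hmono _ _ fun x hx => by simpa [piece] using hx

theorem isAmenableSubset_iff {X : Set G} :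
    IsAmenableSubset X ↔ ¬ HasShrinkingInjection X := by
  refine ⟨fun h hX => hX.not_isAmenableSubset h, fun h => ?_⟩
  obtain ⟨ν, hadd, hinv, hν⟩ := exists_partially_invariant_mean h
  exact isAmenableSubset_of_partially_invariant_mean ν hadd hinv hν

theorem isAmenableGroup_iff : IsAmenableGroup G ↔ IsAmenableSubset (Set.univ : Set G) := by
  constructor
  · rintro ⟨μ, hμ, hadd, hinv, h1⟩
    refine ⟨fun A => ENNReal.ofReal (μ A), fun A B h => ?_, fun g A => ?_, ?_⟩
    · simp only [hadd A B h]
      exact ENNReal.ofReal_add (hμ A).1 (hμ B).1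
    · simp only [hinv]
    · simp [h1]
  · rintro ⟨μ, hadd, hinv, h1⟩
    have hle : ∀ A, μ A ≤ 1 := fun A => by
      have h := hadd A Aᶜ (Set.inter_compl_self A)
      rw [Set.union_compl_self, h1] at h
      exact h ▸ le_self_add
    have htop : ∀ A, μ A ≠ ⊤ := fun A => ((hle A).trans_lt ENNReal.one_lt_top).ne
    refine ⟨fun A => (μ A).toReal, fun A => ⟨ENNReal.toReal_nonneg, ?_⟩, fun A B h => ?_,
      fun g A => ?_, ?_⟩
    · simpa using ENNReal.toReal_mono ENNReal.one_ne_top (hle A)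
    · simp only [hadd A B h]
      exact ENNReal.toReal_add (htop A) (htop B)
    · simp only [hinv]
    · simp [h1]

/-! ### Amenability and generating numbers -/

theorem isAmenableSubset_iff_forall_hasUGN_iff {X : Set G} :
    IsAmenableSubset X ↔
      ∀ (R : Type v) [Ring R], (HasUGN (TranslationRing X R) ↔ HasUGN R) := by
  rw [isAmenableSubset_iff]
  refine ⟨fun h R _ => ⟨fun hT => hT.of_ringHom (TranslationRing.scalar X R),
    fun hR => hR.translationRing h⟩, fun h hX => ?_⟩
  -- The lift places `ℤ` in the universe of the coefficient rings.
  exact hX.not_hasUGN (ULift.{v} ℤ) ((h (ULift.{v} ℤ)).2 (hasUGN_of_commRing _))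

end Displacement

theorem corollary3p3 (G : Type u) [Group G] :
    (IsSupramenableGroup G ↔
      ∀ (R : Type v) [Ring R] (X : Set G), X.Nonempty →
        (HasUGN (TranslationRing X R) ↔ HasUGN R)) ∧
    (IsAmenableGroup G ↔
      ∀ (R : Type v) [Ring R],
        (HasUGN (TranslationRing (Set.univ : Set G) R) ↔ HasUGN R)) := by
  refine ⟨⟨fun h R _ X hX => isAmenableSubset_iff_forall_hasUGN_iff.1 (h X hX) R,
    fun h X hX => isAmenableSubset_iff_forall_hasUGN_iff.2 fun R _ => h R X hX⟩, ?_⟩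
  rw [isAmenableGroup_iff, isAmenableSubset_iff_forall_hasUGN_iff]
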